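/- **Setting.** Let $\mathcal W,\mathcal X,\hat{\mathcal W}$ be measurable spaces, $\mathcal P_W$ a probability measure on $\mathcal W$, $\{\mathcal P_{X|W=w}\}_{w\in\mathcal W}$ a family of probability measures on $\mathcal X$ depending measurably on $w$, and $\ell:\mathcal W\times\hat{\mathcal W}\to[0,\infty)$ a measurable loss function. Let $(W,X)$ have the joint law $\mathcal P_{WX}(dw,dx)=\mathcal P_W(dw)\,\mathcal P_{X|W=w}(dx)$. Define - the Bayesian risk $R_B=\inf_\phi \mathbb E[\ell(W,\phi(X))]\in[0,\infty]$, the infimum being over all measurable $\phi:\mathcal X\to\hat{\mathcal W}$; - the small-ball probability $L_W(\rho)=\sup_{\hat w\in\hat{\mathcal W}}\mathcal P_W(\ell(W,\hat w)<\rho)$; - for $\alpha>1$, Sibson's $\alpha$-mutual information $I_\alpha(W,X)=\inf_{\mathcal Q_X}D_\alpha(\mathcal P_{WX}\|\mathcal P_W\times\mathcal Q_X)$ over all probability measures $\mathcal Q_X$ on $\mathcal X$, where $D_\alpha(\mathcal P\|\mathcal Q)=\frac1{\alpha-1}\log\int p^\alpha q^{1-\alpha}\,d\mu\in[0,\infty]$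 is Rényi's divergence, $p,q$ being the densities of $\mathcal P,\mathcal Q$ with respect to a dominating measure $\mu$; - the maximal leakage $\mathcal L(W\to X)=\sup\log\frac{\mathbb P(U=\hat U)}{\max_u\mathbb P(U=u)}\in[0,\infty]$, the supremum being over all Markov chains $U-W-X-\hat U$ in which $U$ and $\hat U$ take values in a common finite, but arbitrary, alphabet. Use $\log 0=-\infty$, $\exp(-\infty)=0$, $\exp(\infty)=\infty$ and the convention $\infty+(-\infty)=\infty$ (so that the bounds below are vacuous when the information measure is infinite). **Theorem.** For every $\alpha>1$ and every $\rho>0$, $$R_B\;\ge\;\rho\left(1-\exp\left(\frac{\alpha-1}{\alpha}\bigl(I_\alpha(W,X)+\log L_W(\rho)\bigr)\right)\right).$$ Moreover (the case $\alpha\to\infty$), $$R_B\;\ge\;\sup_{\rho>0}\,\rho\Bigl(1-\exp\bigl(\mathcal L(W\to X)+\log L_W(\rho)\bigr)\Bigr).$$ -/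

import Mathlib

open MeasureTheory ProbabilityTheory
open scoped NNReal ENNReal

noncomputable section

namespace BayesBound

variable {Ω 𝓦 𝓧 𝓥 : Type*} [MeasurableSpace Ω] [MeasurableSpace 𝓦] [MeasurableSpace 𝓧]
  [MeasurableSpace 𝓥]

/-- Addition of extended reals with the convention `∞ + (-∞) = (-∞) + ∞ = ∞`
(Mathlib's `+` has `⊤ + ⊥ = ⊥`); in all other cases it is the usual sum. -/
def upperAdd (a b : EReal) : EReal := -(-a + -b)

/-- Rényi's `α`-divergence `D_α(P‖Q) = (α - 1)⁻¹ log ∫ p ^ α q ^ (1 - α) dμ` (for `α > 0`, `α ≠ 1`),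
where `p`, `q` are the densities of `P`, `Q` with respect to the dominating measure `μ = P + Q`.
The integral takes values in `[0, ∞]` and `log 0 = -∞`, `log ∞ = ∞`. -/
def renyiDiv (α : ℝ) (P Q : Measure Ω) : EReal :=
  (((α - 1)⁻¹ : ℝ) : EReal) *
    ENNReal.log (∫⁻ ω, P.rnDeriv (P + Q) ω ^ α * Q.rnDeriv (P + Q) ω ^ (1 - α) ∂(P + Q))

/-- Sibson's mutual information of order `α` of a pair with joint law `P`: the minimum over all
probability measures `Q` on the second space of `D_α(P ‖ P₁ × Q)`, `P₁` the first marginal. -/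
def sibsonMI (α : ℝ) (P : Measure (𝓦 × 𝓧)) : EReal :=
  ⨅ Q : ProbabilityMeasure 𝓧, renyiDiv α P (P.fst.prod (Q : Measure 𝓧))

/-- Maximal leakage from `W` to `X`, for a pair `(W, X)` with joint law `P`:
the supremum of `log (ℙ(U = Û) / max_u ℙ(U = u))` over all Markov chains `U - W - X - Û` where
`U` and `Û` take values in a common finite alphabet, here `Fin n` with `n` arbitrary. Such a chain is
given by the conditional laws `η` of `U` given `W` and `ζ` of `Û` given `X`; the joint law of
`(U, Û)` is then `(η ∥ₖ ζ) ∘ₘ P` and the law of `U` is `η ∘ₘ P.fst`. -/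
def maximalLeakage (P : Measure (𝓦 × 𝓧)) : EReal :=
  ⨆ (n : ℕ) (η : Kernel 𝓦 (Fin n)) (ζ : Kernel 𝓧 (Fin n))
    (_ : IsMarkovKernel η) (_ : IsMarkovKernel ζ),
    ENNReal.log (((η ∥ₖ ζ) ∘ₘ P) {q : Fin n × Fin n | q.1 = q.2} /
      ⨆ u : Fin n, (η ∘ₘ P.fst) {u})

/-- The Bayesian risk `inf_φ E[ℓ(W, φ(X))]`, where `(W, X)` has joint law `P` and `φ` ranges over
all (measurable) estimators. -/
def bayesianRisk (ℓ : 𝓦 → 𝓥 → ℝ≥0) (P : Measure (𝓦 × 𝓧)) : ℝ≥0∞ :=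
  ⨅ (φ : 𝓧 → 𝓥) (_ : Measurable φ), ∫⁻ p, (ℓ p.1 (φ p.2) : ℝ≥0∞) ∂P

/-- The small-ball probability `L_W(ρ) = sup_v P_W(ℓ(W, v) < ρ)`, `π` being the law of `W`. -/
def smallBall (ℓ : 𝓦 → 𝓥 → ℝ≥0) (π : Measure 𝓦) (ρ : ℝ) : ℝ≥0∞ :=
  ⨆ v : 𝓥, π {w | (ℓ w v : ℝ) < ρ}

end BayesBound

end

/-! By Markov's inequality the risk of an estimator `φ` is at least `ρ` times the probability that
its loss is at least `ρ`, so it suffices to bound the success probability `P(ℓ(W, φ(X)) < ρ)`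
uniformly in `φ` (`le_bayesianRisk`). Under a product law `π × ν`, freezing `x` freezes the guess `φ
x`, so Fubini bounds success by `L_W(ρ)` times the mass of `ν` (`prod_successSet_le`). What remains
is to pass from a product law to the joint law.

For finite `α` this is Hölder's inequality with exponents `α` and `α/(α-1)`
(`log_measure_le_renyiDiv`), followed by the infimum over `Q`.

For maximal leakage, a measure `ν` of mass at most `exp 𝓛` with `P ≤ π × ν` is needed
(`exists_le_prod_of_maximalLeakage_ne_top`). Its density with respect to the law of `X` is the
essential supremum, over events `A` of positive probability, of the density of the law of `X` given
`W ∈ A`. The maximum of finitely many such densities integrates to the gain of guessing the most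
likely `A` from `X`, which a suitable finite alphabet turns into a leakage ratio. Domination holds
on rectangles by construction and extends by approximation. -/

namespace BayesBound

/-! ### Domination on products, essential suprema, measurable argmax. -/

section Measure

variable {α β : Type*} [MeasurableSpace α] [MeasurableSpace β]

/-- The sets determined by finitely many measurable pieces in each factor. -/
def rectangleAlgebra (α β : Type*) [MeasurableSpace α] [MeasurableSpace β] : Set (Set (α × β)) :=
  {E | ∃ (ι κ : Type) (_ : Finite ι) (_ : Finite κ) (f : α → ι) (g : β → κ) (S : Set (ι × κ)),
    (∀ i, MeasurableSet (f ⁻¹' {i})) ∧ (∀ j, MeasurableSet (g ⁻¹' {j})) ∧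
      E = Prod.map f g ⁻¹' S}

lemma isSetAlgebra_rectangleAlgebra : IsSetAlgebra (rectangleAlgebra α β) where
  empty_mem := ⟨Unit, Unit, inferInstance, inferInstance, fun _ ↦ (), fun _ ↦ (), ∅,
    fun _ ↦ by simp, fun _ ↦ by simp, by simp⟩
  compl_mem := by
    rintro _ ⟨ι, κ, hι, hκ, f, g, S, hf, hg, rfl⟩
    exact ⟨ι, κ, hι, hκ, f, g, Sᶜ, hf, hg, rfl⟩
  union_mem := by
    rintro _ _ ⟨ι, κ, hι, hκ, f, g, S, hf, hg, rfl⟩ ⟨ι', κ', hι', hκ', f', g', S', hf', hg', rfl⟩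
    refine ⟨ι × ι', κ × κ', inferInstance, inferInstance, fun a ↦ (f a, f' a),
      fun b ↦ (g b, g' b), {p | (p.1.1, p.2.1) ∈ S ∨ (p.1.2, p.2.2) ∈ S'}, ?_, ?_, rfl⟩
    · rintro ⟨i, j⟩
      convert (hf i).inter (hf' j) using 1
      ext; simp
    · rintro ⟨i, j⟩
      convert (hg i).inter (hg' j) using 1
      ext; simp

lemma measurableSet_of_mem_rectangleAlgebra {E : Set (α × β)} (hE : E ∈ rectangleAlgebra α β) :
    MeasurableSet E := by
  obtain ⟨ι, κ, _, _, f, g, S, hf, hg, rfl⟩ := hE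
  rw [← Set.biUnion_preimage_singleton]
  refine MeasurableSet.biUnion S.to_countable fun p _ ↦ ?_
  convert (hf p.1).prod (hg p.2) using 1
  ext; simp [Prod.ext_iff]

lemma generateFrom_rectangleAlgebra :
    (inferInstance : MeasurableSpace (α × β)) =
      MeasurableSpace.generateFrom (rectangleAlgebra α β) := by
  refine le_antisymm ?_ (MeasurableSpace.generateFrom_le fun _ ↦
    measurableSet_of_mem_rectangleAlgebra)
  refine generateFrom_prod.symm.le.trans (MeasurableSpace.generateFrom_mono ?_)
  rintro _ ⟨s, hs, t, ht, rfl⟩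
  refine ⟨Prop, Prop, inferInstance, inferInstance, (· ∈ s), (· ∈ t), {(True, True)},
    fun p ↦ ?_, fun p ↦ ?_, by ext; simp [Prod.ext_iff]⟩
  · exact (measurable_mem.mpr hs) (measurableSet_singleton p)
  · exact (measurable_mem.mpr ht) (measurableSet_singleton p)

/-- A finite measure on a product is dominated by another one as soon as this holds on
rectangles. -/
lemma le_of_forall_prod_le {μ ν : Measure (α × β)} [IsFiniteMeasure μ] [IsFiniteMeasure ν]
    (h : ∀ s t, MeasurableSet s → MeasurableSet t → μ (s ×ˢ t) ≤ ν (s ×ˢ t)) : μ ≤ ν := by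
  have halg : ∀ E ∈ rectangleAlgebra α β, μ E ≤ ν E := by
    rintro _ ⟨ι, κ, _, _, f, g, S, hf, hg, rfl⟩
    have hfib : ∀ p : ι × κ, Prod.map f g ⁻¹' {p} = (f ⁻¹' {p.1}) ×ˢ (g ⁻¹' {p.2}) := by
      intro p; ext; simp [Prod.ext_iff]
    have hm : ∀ p : ι × κ, MeasurableSet (Prod.map f g ⁻¹' {p}) := fun p ↦ by
      rw [hfib]; exact (hf _).prod (hg _)
    have hS := S.toFinite.coe_toFinset
    rw [← hS, ← sum_measure_preimage_singleton _ (fun p _ ↦ hm p),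
      ← sum_measure_preimage_singleton _ (fun p _ ↦ hm p)]
    refine Finset.sum_le_sum fun p _ ↦ ?_
    rw [hfib]
    exact h _ _ (hf _) (hg _)
  refine Measure.le_iff.2 fun E hE ↦ ?_
  -- Approximating with respect to `μ + ν` makes the error small for both measures at once.
  have hd := Measure.MeasureDense.of_generateFrom_isSetAlgebra_finite (μ + ν)
    isSetAlgebra_rectangleAlgebra (generateFrom_rectangleAlgebra (α := α) (β := β))
  refine ENNReal.le_of_forall_pos_le_add fun ε hε _ ↦ ?_
  obtain ⟨F, hF, hEF⟩ := hd.approx E hE (measure_ne_top _ _) ε hε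
  rw [ENNReal.ofReal_coe_nnreal, Measure.add_apply] at hEF
  calc μ E ≤ μ F + μ (symmDiff E F) := by
        refine (measure_mono fun x hx ↦ ?_).trans (measure_union_le _ _)
        by_cases hxF : x ∈ F
        · exact .inl hxF
        · exact .inr (.inl ⟨hx, hxF⟩)
    _ ≤ ν F + μ (symmDiff E F) := add_le_add_left (halg F hF) _
    _ ≤ (ν E + ν (symmDiff E F)) + μ (symmDiff E F) := by
        gcongr
        refine (measure_mono fun x hx ↦ ?_).trans (measure_union_le _ _)
        by_cases hxE : x ∈ E
        · exact .inl hxE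
        · exact .inr (.inr ⟨hx, hxE⟩)
    _ = ν E + (μ (symmDiff E F) + ν (symmDiff E F)) := by ring
    _ ≤ ν E + ε := by gcongr

/-- An essential supremum of a family of functions, with its integral bounded by the integrals of
the suprema of countable subfamilies. -/
lemma exists_ae_upper_bound {ι : Type*} [Nonempty ι] (μ : Measure α) (f : ι → α → ℝ≥0∞)
    (hf : ∀ i, Measurable (f i)) {M : ℝ≥0∞} (hM : M ≠ ∞)
    (h : ∀ s : ℕ → ι, ∫⁻ x, ⨆ k, f (s k) x ∂μ ≤ M) :
    ∃ g : α → ℝ≥0∞, Measurable g ∧ ∫⁻ x, g x ∂μ ≤ M ∧ ∀ i, f i ≤ᵐ[μ] g := by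
  let I : (ℕ → ι) → ℝ≥0∞ := fun s ↦ ∫⁻ x, ⨆ k, f (s k) x ∂μ
  obtain ⟨u, -, hu, hmem⟩ := exists_seq_tendsto_sSup (Set.range_nonempty I) (OrderTop.bddAbove _)
  choose s hs using hmem
  let t : ℕ → ι := fun k ↦ s k.unpair.1 k.unpair.2
  have ht : ∀ n k, ∃ m, t m = s n k := fun n k ↦ ⟨Nat.pair n k, by simp [t]⟩
  have hmax : ∀ r, I r ≤ I t := fun r ↦ by
    refine (le_sSup (Set.mem_range_self r)).trans (le_of_tendsto' hu fun n ↦ ?_)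
    rw [← hs]
    refine lintegral_mono fun x ↦ iSup_le fun k ↦ ?_
    obtain ⟨m, hm⟩ := ht n k
    rw [← hm]
    exact le_iSup (fun k ↦ f (t k) x) m
  refine ⟨fun x ↦ ⨆ k, f (t k) x, .iSup fun k ↦ hf _, h t, fun i ↦ ?_⟩
  -- Prepending `i` to the maximizing sequence `t` can only raise the supremum pointwise, yet cannot
  -- raise its finite integral, so the two suprema agree almost everywhere.
  let r : ℕ → ι := fun k ↦ Nat.casesOn k i t
  have hle : (fun x ↦ ⨆ k, f (t k) x) ≤ᵐ[μ] fun x ↦ ⨆ k, f (r k) x :=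
    .of_forall fun x ↦ iSup_le fun k ↦ le_iSup (fun k ↦ f (r k) x) (k + 1)
  have heq := ae_eq_of_ae_le_of_lintegral_le hle ((h t).trans_lt hM.lt_top).ne
    (Measurable.iSup fun k ↦ hf _).aemeasurable (hmax r)
  filter_upwards [heq] with x hx
  rw [hx]
  exact le_iSup (fun k ↦ f (r k) x) 0

/-- A measurable choice of an index realizing the maximum of finitely many functions. -/
lemma exists_measurable_argmax (f : ℕ → α → ℝ≥0∞) (hf : ∀ i, Measurable (f i)) (n : ℕ) :
    ∃ g : α → ℕ, Measurable g ∧ (∀ x, g x ≤ n) ∧ ∀ x, ∀ k ≤ n, f k x ≤ f (g x) x := by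
  induction n with
  | zero => exact ⟨fun _ ↦ 0, measurable_const, fun _ ↦ le_rfl, fun x k hk ↦ by
      obtain rfl : k = 0 := by omega
      rfl⟩
  | succ n ih =>
    obtain ⟨g, hg, hgn, hmax⟩ := ih
    have hm : Measurable fun x ↦ f (g x) x :=
      (measurable_from_prod_countable_right (f := fun p : ℕ × α ↦ f p.1 p.2) hf).comp
        (hg.prodMk measurable_id)
    refine ⟨fun x ↦ if f (g x) x < f (n + 1) x then n + 1 else g x,
      Measurable.ite (measurableSet_lt hm (hf _)) measurable_const hg, fun x ↦ ?_, fun x k hk ↦ ?_⟩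
    · dsimp only
      split_ifs
      · exact le_rfl
      · exact (hgn x).trans n.le_succ
    · dsimp only
      split_ifs with hlt
      · rcases hk.lt_or_eq with hk | rfl
        · exact (hmax x k (by omega)).trans hlt.le
        · exact le_rfl
      · rcases hk.lt_or_eq with hk | rfl
        · exact hmax x k (by omega)
        · exact not_lt.1 hlt

end Measure

/-! ### Extended-real arithmetic with `∞ + (-∞) = ∞`. -/

section EReal

lemma top_upperAdd (b : EReal) : upperAdd ⊤ b = ⊤ := by simp [upperAdd]

lemma upperAdd_top (b : EReal) : upperAdd b ⊤ = ⊤ := by simp [upperAdd]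

lemma upperAdd_bot {a : EReal} (h : a ≠ ⊤) : upperAdd a ⊥ = ⊥ := by
  unfold upperAdd
  induction a <;> simp_all

lemma upperAdd_coe (a : EReal) (b : ℝ) : upperAdd a b = a + b := by
  unfold upperAdd
  induction a with
  | bot => simp [← EReal.coe_neg]
  | top => simp [← EReal.coe_neg]
  | coe a => exact_mod_cast (by ring : -(-a + -b) = a + b)

lemma add_le_upperAdd (a b : EReal) : a + b ≤ upperAdd a b := by
  induction b with
  | bot => simp
  | top => simp [upperAdd_top]
  | coe b => exact (upperAdd_coe a b).ge

/-- For real `b` this is translation. For `b = ⊥`, one term other than `⊤` already forces `a = ⊥`;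
if there is none, the infimum is `⊤` as well. -/
lemma le_upperAdd_iInf {ι : Sort*} {D : ι → EReal} {a b : EReal}
    (h : ∀ i, a ≤ upperAdd (D i) b) : a ≤ upperAdd (⨅ i, D i) b := by
  induction b with
  | top => simp [upperAdd_top]
  | bot =>
    by_cases hD : ∃ i, D i ≠ ⊤
    · obtain ⟨i, hi⟩ := hD
      have := h i
      rw [upperAdd_bot hi] at this
      exact this.trans bot_le
    · push Not at hD
      simp [hD, top_upperAdd]
  | coe b =>
    rw [upperAdd_coe]
    rw [← EReal.sub_le_iff_le_add (.inl (EReal.coe_ne_bot _)) (.inl (EReal.coe_ne_top _))]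
    refine le_iInf fun i ↦ ?_
    rw [EReal.sub_le_iff_le_add (.inl (EReal.coe_ne_bot _)) (.inl (EReal.coe_ne_top _)),
      ← upperAdd_coe]
    exact h i

lemma le_coe_mul_iff {c : ℝ} (hc : 0 < c) {a b : EReal} :
    a ≤ c * b ↔ ((c⁻¹ : ℝ) : EReal) * a ≤ b := by
  have hc' : (0 : EReal) ≤ c := EReal.coe_nonneg.2 hc.le
  have hi' : (0 : EReal) ≤ (c⁻¹ : ℝ) := EReal.coe_nonneg.2 (inv_pos.2 hc).le
  constructor <;> intro h
  · refine (mul_le_mul_of_nonneg_left h hi').trans_eq ?_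
    rw [← mul_assoc, ← EReal.coe_mul, inv_mul_cancel₀ hc.ne', EReal.coe_one, one_mul]
  · refine Eq.trans_le ?_ (mul_le_mul_of_nonneg_left h hc')
    rw [← mul_assoc, ← EReal.coe_mul, mul_inv_cancel₀ hc.ne', EReal.coe_one, one_mul]

end EReal

/-! ### From success probabilities to the risk. -/

section Risk

variable {𝓦 𝓧 𝓥 : Type*} [MeasurableSpace 𝓦] [MeasurableSpace 𝓧] [MeasurableSpace 𝓥]

/-- The event that the estimator `φ` incurs a loss less than `ρ`. -/
def successSet (ℓ : 𝓦 → 𝓥 → ℝ≥0) (φ : 𝓧 → 𝓥) (ρ : ℝ) : Set (𝓦 × 𝓧) :=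
  {p | (ℓ p.1 (φ p.2) : ℝ) < ρ}

lemma measurable_loss {ℓ : 𝓦 → 𝓥 → ℝ≥0} (hℓ : Measurable (Function.uncurry ℓ)) {φ : 𝓧 → 𝓥}
    (hφ : Measurable φ) : Measurable fun p : 𝓦 × 𝓧 ↦ ℓ p.1 (φ p.2) :=
  hℓ.comp (measurable_fst.prodMk (hφ.comp measurable_snd))

lemma measurableSet_successSet {ℓ : 𝓦 → 𝓥 → ℝ≥0} (hℓ : Measurable (Function.uncurry ℓ))
    {φ : 𝓧 → 𝓥} (hφ : Measurable φ) (ρ : ℝ) : MeasurableSet (successSet ℓ φ ρ) :=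
  measurableSet_lt (measurable_loss hℓ hφ).coe_nnreal_real measurable_const

/-- Under a product law, the success probability is at most the small-ball probability. -/
lemma prod_successSet_le {ℓ : 𝓦 → 𝓥 → ℝ≥0} (hℓ : Measurable (Function.uncurry ℓ)) {φ : 𝓧 → 𝓥}
    (hφ : Measurable φ) (ρ : ℝ) (π : Measure 𝓦) [SFinite π] (ν : Measure 𝓧) [SFinite ν] :
    π.prod ν (successSet ℓ φ ρ) ≤ smallBall ℓ π ρ * ν Set.univ := by
  rw [Measure.prod_apply_symm (measurableSet_successSet hℓ hφ ρ), ← lintegral_const]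
  exact lintegral_mono fun x ↦ le_iSup (fun v ↦ π {w | (ℓ w v : ℝ) < ρ}) (φ x)

/-- Markov's inequality: a bound on the success probability of all estimators bounds the risk. -/
lemma le_bayesianRisk {ℓ : 𝓦 → 𝓥 → ℝ≥0} (hℓ : Measurable (Function.uncurry ℓ))
    (P : Measure (𝓦 × 𝓧)) [IsProbabilityMeasure P] {ρ : ℝ} (hρ : 0 < ρ) {t : ℝ≥0∞}
    (h : ∀ φ : 𝓧 → 𝓥, Measurable φ → P (successSet ℓ φ ρ) ≤ t) :
    (ρ : EReal) * (1 - (t : EReal)) ≤ (bayesianRisk ℓ P : EReal) := by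
  have key : ENNReal.ofReal ρ * (1 - t) ≤ bayesianRisk ℓ P := by
    refine le_iInf₂ fun φ hφ ↦ ?_
    have hE := measurableSet_successSet hℓ hφ ρ
    calc ENNReal.ofReal ρ * (1 - t) ≤ ENNReal.ofReal ρ * P (successSet ℓ φ ρ)ᶜ := by
          rw [prob_compl_eq_one_sub hE]
          gcongr
          exact h φ hφ
      _ ≤ ENNReal.ofReal ρ * P {p | ENNReal.ofReal ρ ≤ (ℓ p.1 (φ p.2) : ℝ≥0∞)} := by
          gcongr
          intro p hp
          have hp : ρ ≤ (ℓ p.1 (φ p.2) : ℝ) := not_lt.1 hp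
          exact ENNReal.ofReal_le_of_le_toReal hp
      _ ≤ _ := mul_meas_ge_le_lintegral (measurable_loss hℓ hφ).coe_nnreal_ennreal _
  -- Subtraction truncates in `ℝ≥0∞` but not in `EReal`; for `1 ≤ t` the claimed lower bound is
  -- nonpositive.
  by_cases ht : 1 ≤ t
  · have h1 : (1 : EReal) - (t : EReal) ≤ 0 := by
      refine EReal.sub_le_of_le_add ?_
      rw [zero_add]
      exact_mod_cast ht
    exact (mul_nonpos_of_nonneg_of_nonpos (EReal.coe_nonneg.2 hρ.le) h1).trans
      (EReal.coe_ennreal_nonneg _)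
  · push Not at ht
    refine le_trans (le_of_eq ?_) (EReal.coe_ennreal_le_coe_ennreal_iff.2 key)
    lift t to ℝ≥0 using ht.ne_top
    have ht' : t ≤ 1 := by exact_mod_cast ht.le
    rw [EReal.coe_ennreal_mul, EReal.coe_ennreal_ofReal, max_eq_left hρ.le]
    congr 1
    rw [← ENNReal.coe_one, ← ENNReal.coe_sub, EReal.coe_nnreal_eq_coe_real,
      EReal.coe_nnreal_eq_coe_real, NNReal.coe_sub ht']
    simp

end Risk

/-! ### Change of measure by Rényi divergence. -/

section Renyi

variable {Ω : Type*} [MeasurableSpace Ω]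

/-- Hölder's inequality for the probability of an event under two laws. -/
lemma measure_le_renyi_rpow {α : ℝ} (hα : 1 < α) (P Q : Measure Ω) [IsFiniteMeasure P]
    [IsFiniteMeasure Q] {E : Set Ω} (hE : MeasurableSet E)
    (hJ : ∫⁻ ω, P.rnDeriv (P + Q) ω ^ α * Q.rnDeriv (P + Q) ω ^ (1 - α) ∂(P + Q) ≠ ∞) :
    P E ≤ (∫⁻ ω, P.rnDeriv (P + Q) ω ^ α * Q.rnDeriv (P + Q) ω ^ (1 - α) ∂(P + Q)) ^ α⁻¹ *
      Q E ^ ((α - 1) / α) := by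
  set μ := P + Q with hμ
  have hPμ : P ≪ μ := (Measure.le_add_right le_rfl).absolutelyContinuous
  have hQμ : Q ≪ μ := (Measure.le_add_left le_rfl).absolutelyContinuous
  have hα0 : 0 < α := by linarith
  set c := (α - 1) / α with hc
  have hc0 : 0 < c := div_pos (by linarith) hα0
  have hp := Measure.measurable_rnDeriv P μ
  have hq := Measure.measurable_rnDeriv Q μ
  have hconj : α.HolderConjugate c⁻¹ := by
    rw [Real.holderConjugate_iff]
    refine ⟨hα, ?_⟩
    rw [inv_inv, hc]
    field_simp
    ring
  have hae : ∀ᵐ ω ∂μ, P.rnDeriv μ ω ≤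
      (P.rnDeriv μ ω * Q.rnDeriv μ ω ^ (-c)) * Q.rnDeriv μ ω ^ c := by
    filter_upwards [ae_lt_top ((hp.pow_const α).mul (hq.pow_const (1 - α))) hJ,
      Measure.rnDeriv_lt_top Q μ] with ω h1 h2
    -- Where `q = 0`, the factor `q ^ (1 - α)` is `∞` because `α > 1`, so finiteness of the
    -- integrand forces `p = 0`.
    by_cases hq0 : Q.rnDeriv μ ω = 0
    · by_cases hp0 : P.rnDeriv μ ω = 0
      · simp [hp0]
      · simp only [Pi.mul_apply, hq0] at h1
        rw [ENNReal.zero_rpow_of_neg (by linarith), ENNReal.mul_top] at h1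
        · exact absurd h1 (lt_irrefl _)
        · simp [ENNReal.rpow_eq_zero_iff, hp0, hα0.le]
    · rw [mul_assoc, ← ENNReal.rpow_add _ _ hq0 h2.ne]
      simp
  have hint : ∀ ω, (P.rnDeriv μ ω * Q.rnDeriv μ ω ^ (-c)) ^ α =
      P.rnDeriv μ ω ^ α * Q.rnDeriv μ ω ^ (1 - α) := fun ω ↦ by
    rw [ENNReal.mul_rpow_of_nonneg _ _ hα0.le, ← ENNReal.rpow_mul]
    congr 2
    rw [hc]
    field_simp
    ring
  have hind : ∀ ω, (E.indicator (fun ω ↦ Q.rnDeriv μ ω ^ c) ω) ^ c⁻¹ =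
      E.indicator (Q.rnDeriv μ) ω := fun ω ↦ by
    by_cases h : ω ∈ E
    · simp [h, ENNReal.rpow_rpow_inv hc0.ne']
    · simp [h, ENNReal.zero_rpow_of_pos, hc0]
  have hH := ENNReal.lintegral_mul_le_Lp_mul_Lq μ hconj
    (f := fun ω ↦ P.rnDeriv μ ω * Q.rnDeriv μ ω ^ (-c))
    (g := E.indicator (fun ω ↦ Q.rnDeriv μ ω ^ c))
    (hp.mul (hq.pow_const _)).aemeasurable ((hq.pow_const _).indicator hE).aemeasurable
  simp only [hint, hind, one_div, inv_inv] at hH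
  rw [lintegral_indicator hE, Measure.setLIntegral_rnDeriv hQμ] at hH
  refine le_trans ?_ hH
  rw [← Measure.setLIntegral_rnDeriv hPμ, ← lintegral_indicator hE]
  refine lintegral_mono_ae ?_
  filter_upwards [hae] with ω hω
  by_cases h : ω ∈ E
  · simpa [h] using hω
  · simp [h]

/-- The logarithmic form of `measure_le_renyi_rpow`, in which `Q E` may be replaced by any larger
number. -/
lemma log_measure_le_renyiDiv {α : ℝ} (hα : 1 < α) (P Q : Measure Ω) [IsFiniteMeasure P]
    [IsFiniteMeasure Q] {E : Set Ω} (hE : MeasurableSet E) {b : ℝ≥0∞} (hb : Q E ≤ b) :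
    ENNReal.log (P E) ≤ (((α - 1) / α : ℝ) : EReal) *
      upperAdd (renyiDiv α P Q) (ENNReal.log b) := by
  have hα0 : 0 < α := by linarith
  have hα1 : 0 < α - 1 := by linarith
  have hc0 : 0 < (α - 1) / α := div_pos hα1 hα0
  by_cases hJ : ∫⁻ ω, P.rnDeriv (P + Q) ω ^ α * Q.rnDeriv (P + Q) ω ^ (1 - α) ∂(P + Q) = ∞
  · rw [renyiDiv, hJ, ENNReal.log_top, EReal.coe_mul_top_of_pos (inv_pos.2 hα1), top_upperAdd,
      EReal.coe_mul_top_of_pos hc0]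
    exact le_top
  · have h := ENNReal.log_monotone ((measure_le_renyi_rpow hα P Q hE hJ).trans
      (mul_le_mul_right (ENNReal.rpow_le_rpow hb hc0.le) _))
    rw [ENNReal.log_mul_add, ENNReal.log_rpow, ENNReal.log_rpow] at h
    refine h.trans (le_trans (le_of_eq ?_) (mul_le_mul_of_nonneg_left (add_le_upperAdd _ _)
      (EReal.coe_nonneg.2 hc0.le)))
    rw [EReal.left_distrib_of_nonneg_of_ne_top (EReal.coe_nonneg.2 hc0.le) (EReal.coe_ne_top _),
      renyiDiv, ← mul_assoc, ← EReal.coe_mul]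
    congr 3
    field_simp

end Renyi

/-! ### Change of measure by maximal leakage. -/

section Leakage

variable {𝓦 𝓧 : Type*} [MeasurableSpace 𝓦] [MeasurableSpace 𝓧]

/-- The kernel to a finite alphabet with given measurable weights. -/
noncomputable def weightKernel {n : ℕ} (c : Fin n → 𝓦 → ℝ≥0∞) (hc : ∀ u, Measurable (c u)) :
    Kernel 𝓦 (Fin n) where
  toFun w := ∑ u, c u w • Measure.dirac u
  measurable' := by
    refine Measure.measurable_of_measurable_coe _ fun s hs ↦ ?_
    simp only [Measure.coe_finsetSum, Finset.sum_apply, Measure.smul_apply, smul_eq_mul]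
    exact Finset.measurable_sum _ fun u _ ↦ (hc u).mul_const _

lemma weightKernel_singleton {n : ℕ} {c : Fin n → 𝓦 → ℝ≥0∞} (hc : ∀ u, Measurable (c u)) (w : 𝓦)
    (u : Fin n) : weightKernel c hc w {u} = c u w := by
  simp [weightKernel, Measure.dirac_apply' _ (measurableSet_singleton u), Set.indicator_apply]

lemma isMarkovKernel_weightKernel {n : ℕ} {c : Fin n → 𝓦 → ℝ≥0∞} (hc : ∀ u, Measurable (c u))
    (h : ∀ w, ∑ u, c u w = 1) : IsMarkovKernel (weightKernel c hc) :=
  ⟨fun w ↦ ⟨by simp [weightKernel, h]⟩⟩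

/-- The gain of any finite guessing strategy is bounded by the maximal leakage. -/
lemma log_guessing_le_maximalLeakage (P : Measure (𝓦 × 𝓧)) {n : ℕ} {c : Fin n → 𝓦 → ℝ≥0∞}
    (hc : ∀ u, Measurable (c u)) (h1 : ∀ w, ∑ u, c u w = 1) {g : 𝓧 → Fin n} (hg : Measurable g)
    {δ : ℝ≥0∞} (hδ : ∀ u, ∫⁻ w, c u w ∂P.fst ≤ δ) :
    ENNReal.log ((∫⁻ p, c (g p.2) p.1 ∂P) / δ) ≤ maximalLeakage P := by
  have := isMarkovKernel_weightKernel hc h1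
  have hζ : IsMarkovKernel (Kernel.deterministic g hg) := inferInstance
  refine le_trans ?_ (le_iSup₂_of_le n (weightKernel c hc)
    (le_iSup₂_of_le (Kernel.deterministic g hg) this (le_iSup_of_le hζ le_rfl)))
  refine ENNReal.log_monotone (ENNReal.div_le_div (le_of_eq ?_) (iSup_le fun u ↦ ?_))
  · have hd : MeasurableSet {q : Fin n × Fin n | q.1 = q.2} :=
      measurableSet_eq_fun measurable_fst measurable_snd
    rw [Measure.bind_apply hd (Kernel.aemeasurable _)]
    refine lintegral_congr fun p ↦ ?_
    rw [Kernel.parallelComp_apply, Measure.prod_apply_symm hd, Kernel.deterministic_apply,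
      lintegral_dirac]
    rw [← weightKernel_singleton hc]
    rfl
  · rw [Measure.bind_apply (measurableSet_singleton u) (Kernel.aemeasurable _)]
    simpa only [weightKernel_singleton] using hδ u

/-- The gain of guessing with respect to bounded densities is bounded by the maximal leakage:
the alphabet is completed by equally likely dummy letters. -/
lemma lintegral_le_exp_maximalLeakage (P : Measure (𝓦 × 𝓧)) [IsProbabilityMeasure P]
    {n N : ℕ} (hN : N ≠ 0) {a : ℕ → 𝓦 → ℝ≥0∞} (ha : ∀ j, Measurable (a j))
    (haN : ∀ w, ∑ j ∈ Finset.range n, a j w ≤ N) (ha1 : ∀ j, ∫⁻ w, a j w ∂P.fst ≤ 1)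
    {g : 𝓧 → ℕ} (hg : Measurable g) (hgn : ∀ x, g x < n) :
    ∫⁻ p, a (g p.2) p.1 ∂P ≤ EReal.exp (maximalLeakage P) := by
  have hN0 : (N : ℝ≥0∞) ≠ 0 := by exact_mod_cast hN
  have hNt : (N : ℝ≥0∞) ≠ ∞ := ENNReal.natCast_ne_top N
  let s : 𝓦 → ℝ≥0∞ := fun w ↦ ∑ j ∈ Finset.range n, a j w
  have hs : Measurable s := Finset.measurable_sum _ fun j _ ↦ ha j
  -- The missing mass `1 - s w / N` is shared by `N` dummy letters, so that every letter, real or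
  -- dummy, has probability at most `1 / N`; this factor cancels in the leakage ratio.
  let c : Fin (n + N) → 𝓦 → ℝ≥0∞ := fun u w ↦
    if (u : ℕ) < n then a u w / N else (1 - s w / N) / N
  have hc : ∀ u, Measurable (c u) := fun u ↦ by
    by_cases hu : (u : ℕ) < n
    · simpa only [c, hu, if_true] using (ha u).div_const _
    · simp only [c, hu, if_false]
      exact (measurable_const.sub (hs.div_const _)).div_const _
  have h1 : ∀ w, ∑ u, c u w = 1 := fun w ↦ by
    rw [Fin.sum_univ_add]
    simp only [c, Fin.val_castAdd, Fin.is_lt, if_true, Fin.val_natAdd,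
      Nat.not_lt.2 (Nat.le_add_right _ _), if_false, Finset.sum_const, Finset.card_univ,
      Fintype.card_fin, nsmul_eq_mul]
    rw [ENNReal.mul_div_cancel hN0 hNt, Fin.sum_univ_eq_sum_range (fun j ↦ a j w / N) n]
    simp only [div_eq_mul_inv]
    rw [← Finset.sum_mul, ← div_eq_mul_inv]
    exact add_tsub_cancel_of_le (ENNReal.div_le_of_le_mul (by simpa using haN w))
  have hδ : ∀ u, ∫⁻ w, c u w ∂P.fst ≤ (N : ℝ≥0∞)⁻¹ := fun u ↦ by
    by_cases hu : (u : ℕ) < n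
    · simp only [c, hu, if_true, div_eq_mul_inv]
      rw [lintegral_mul_const _ (ha u)]
      exact mul_le_of_le_one_left' (ha1 u)
    · calc ∫⁻ w, c u w ∂P.fst ≤ ∫⁻ _, (N : ℝ≥0∞)⁻¹ ∂P.fst := by
            refine lintegral_mono fun w ↦ ?_
            simp only [c, hu, if_false, div_eq_mul_inv]
            exact mul_le_of_le_one_left' tsub_le_self
        _ = (N : ℝ≥0∞)⁻¹ := by simp
  let g' : 𝓧 → Fin (n + N) := fun x ↦ ⟨g x, (hgn x).trans_le (Nat.le_add_right _ _)⟩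
  have hg' : Measurable g' := measurable_to_countable' fun u ↦ by
    convert hg (measurableSet_singleton (u : ℕ)) using 1
    ext x; simp [g', Fin.ext_iff]
  have key := EReal.exp_monotone (log_guessing_le_maximalLeakage P hc h1 hg' hδ)
  rw [ENNReal.exp_log] at key
  refine le_trans (le_of_eq ?_) key
  have hcg : ∀ p : 𝓦 × 𝓧, c (g' p.2) p.1 = a (g p.2) p.1 * (N : ℝ≥0∞)⁻¹ := fun p ↦ by
    simp [c, g', hgn, div_eq_mul_inv]
  simp only [hcg]
  rw [lintegral_mul_const' _ _ (ENNReal.inv_ne_top.2 hN0), div_eq_mul_inv, inv_inv, mul_assoc,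
    ENNReal.inv_mul_cancel hN0 hNt, mul_one]

/-- The law of the second variable restricted to the event that the first one lies in `A`. -/
noncomputable def sliceMeasure (P : Measure (𝓦 × 𝓧)) (A : Set 𝓦) : Measure 𝓧 :=
  (P.restrict (A ×ˢ Set.univ)).snd

lemma sliceMeasure_apply (P : Measure (𝓦 × 𝓧)) (A : Set 𝓦) {B : Set 𝓧} (hB : MeasurableSet B) :
    sliceMeasure P A B = P (A ×ˢ B) := by
  rw [sliceMeasure, Measure.snd_apply hB, Measure.restrict_apply (measurable_snd hB)]
  congr 1
  ext; simp [and_comm]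

lemma sliceMeasure_le (P : Measure (𝓦 × 𝓧)) (A : Set 𝓦) : sliceMeasure P A ≤ P.snd :=
  Measure.map_mono Measure.restrict_le_self measurable_snd

/-- The density of the law of the second variable given `A`, relative to its law. -/
noncomputable def sliceDensity (P : Measure (𝓦 × 𝓧)) (A : Set 𝓦) (x : 𝓧) : ℝ≥0∞ :=
  (sliceMeasure P A).rnDeriv P.snd x / P.fst A

lemma measurable_sliceDensity (P : Measure (𝓦 × 𝓧)) (A : Set 𝓦) :
    Measurable (sliceDensity P A) :=
  (Measure.measurable_rnDeriv _ _).div_const _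

lemma setLIntegral_sliceDensity (P : Measure (𝓦 × 𝓧)) [IsProbabilityMeasure P] {A : Set 𝓦}
    {B : Set 𝓧} (hB : MeasurableSet B) :
    ∫⁻ x in B, sliceDensity P A x ∂P.snd = P (A ×ˢ B) / P.fst A := by
  have : IsFiniteMeasure (sliceMeasure P A) := isFiniteMeasure_of_le _ (sliceMeasure_le P A)
  simp only [sliceDensity, div_eq_mul_inv]
  rw [lintegral_mul_const _ (Measure.measurable_rnDeriv _ _), Measure.setLIntegral_rnDeriv
    (sliceMeasure_le P A).absolutelyContinuous, sliceMeasure_apply P A hB]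

/-- The suprema of countably many slice densities integrate to at most the exponential of the
maximal leakage. -/
lemma lintegral_iSup_sliceDensity_le (P : Measure (𝓦 × 𝓧)) [IsProbabilityMeasure P]
    {A : ℕ → Set 𝓦} (hA : ∀ k, MeasurableSet (A k)) (hA0 : ∀ k, P.fst (A k) ≠ 0) :
    ∫⁻ x, ⨆ k, sliceDensity P (A k) x ∂P.snd ≤ EReal.exp (maximalLeakage P) := by
  have hmeas := fun k ↦ measurable_sliceDensity P (A k)
  have hsup : ∀ x, ⨆ k, sliceDensity P (A k) x =
      ⨆ n, ⨆ k : Fin (n + 1), sliceDensity P (A k) x := fun x ↦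
    le_antisymm (iSup_le fun k ↦ le_iSup_of_le k
      (le_iSup (fun j : Fin (k + 1) ↦ sliceDensity P (A j) x) (Fin.last k)))
      (iSup_le fun n ↦ iSup_le fun k ↦ le_iSup (fun k ↦ sliceDensity P (A k) x) k)
  simp only [hsup]
  rw [lintegral_iSup (f := fun n x ↦ ⨆ k : Fin (n + 1), sliceDensity P (A k) x)
    (fun n ↦ .iSup fun k ↦ hmeas _) (fun m n hmn x ↦ iSup_le fun k ↦
    le_iSup (fun j : Fin (n + 1) ↦ sliceDensity P (A j) x) ⟨k, by omega⟩)]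
  refine iSup_le fun n ↦ ?_
  obtain ⟨g, hg, hgn, hmax⟩ := exists_measurable_argmax (fun k ↦ sliceDensity P (A k)) hmeas n
  -- The density, relative to the law of `W`, of that law conditioned on `A k`.
  let a : ℕ → 𝓦 → ℝ≥0∞ := fun k ↦ (A k).indicator fun _ ↦ (P.fst (A k))⁻¹
  have ha : ∀ k, Measurable (a k) := fun k ↦ measurable_const.indicator (hA k)
  have htop : ∑ k ∈ Finset.range (n + 1), (P.fst (A k))⁻¹ ≠ ∞ :=
    ENNReal.sum_ne_top.2 fun k _ ↦ ENNReal.inv_ne_top.2 (hA0 k)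
  obtain ⟨N, hN⟩ := ENNReal.exists_nat_gt htop
  have hN0 : N ≠ 0 := by
    rintro rfl
    simp at hN
  have key := lintegral_le_exp_maximalLeakage P hN0 ha (n := n + 1)
    (fun w ↦ (Finset.sum_le_sum fun k _ ↦ Set.indicator_le_self _ _ _).trans hN.le)
    (fun k ↦ by
      rw [lintegral_indicator_const (hA k)]
      exact ENNReal.inv_mul_le_one _)
    hg (fun x ↦ Nat.lt_succ_of_le (hgn x))
  refine le_trans ?_ key
  have hBm : ∀ k, MeasurableSet (g ⁻¹' {k}) := fun k ↦ hg (measurableSet_singleton k)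
  calc ∫⁻ x, ⨆ k : Fin (n + 1), sliceDensity P (A k) x ∂P.snd
      ≤ ∫⁻ x, ∑ k ∈ Finset.range (n + 1),
          (g ⁻¹' {k}).indicator (sliceDensity P (A k)) x ∂P.snd := by
        refine lintegral_mono fun x ↦ iSup_le fun k ↦ (hmax x k (by omega)).trans ?_
        refine le_trans (le_of_eq ?_) (Finset.single_le_sum
          (f := fun k ↦ (g ⁻¹' {k}).indicator (sliceDensity P (A k)) x) (fun _ _ ↦ zero_le)
          (Finset.mem_range.2 (Nat.lt_succ_of_le (hgn x))))
        simp
    _ = ∑ k ∈ Finset.range (n + 1), P (A k ×ˢ (g ⁻¹' {k})) / P.fst (A k) := by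
        rw [lintegral_finsetSum _ fun k _ ↦ (hmeas k).indicator (hBm k)]
        refine Finset.sum_congr rfl fun k _ ↦ ?_
        rw [lintegral_indicator (hBm k), setLIntegral_sliceDensity P (hBm k)]
    _ = ∫⁻ p, ∑ k ∈ Finset.range (n + 1),
          (A k ×ˢ (g ⁻¹' {k})).indicator (fun _ ↦ (P.fst (A k))⁻¹) p ∂P := by
        rw [lintegral_finsetSum _ fun k _ ↦ measurable_const.indicator ((hA k).prod (hBm k))]
        refine Finset.sum_congr rfl fun k _ ↦ ?_
        rw [lintegral_indicator_const ((hA k).prod (hBm k)), div_eq_mul_inv, mul_comm]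
    _ ≤ ∫⁻ p, a (g p.2) p.1 ∂P := by
        refine lintegral_mono fun p ↦ le_of_eq ?_
        rw [Finset.sum_eq_single (g p.2)]
        · by_cases h : p.1 ∈ A (g p.2) <;> simp [a, Set.indicator, h]
        · intro k _ hk
          simp [hk.symm]
        · intro h
          exact absurd (Finset.mem_range.2 (Nat.lt_succ_of_le (hgn p.2))) h

/-- If the maximal leakage is finite, the joint law is dominated by the product of its first
marginal and a measure whose mass is at most the exponential of the maximal leakage. -/
lemma exists_le_prod_of_maximalLeakage_ne_top (P : Measure (𝓦 × 𝓧)) [IsProbabilityMeasure P]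
    (hL : maximalLeakage P ≠ ⊤) :
    ∃ ν : Measure 𝓧, ν Set.univ ≤ EReal.exp (maximalLeakage P) ∧ IsFiniteMeasure ν ∧
      P ≤ P.fst.prod ν := by
  have hM : EReal.exp (maximalLeakage P) ≠ ∞ := by simpa using hL
  let ι := {A : Set 𝓦 // MeasurableSet A ∧ P.fst A ≠ 0}
  have : Nonempty ι := ⟨⟨Set.univ, .univ, by simp⟩⟩
  obtain ⟨G, hG, hGM, hGle⟩ := exists_ae_upper_bound P.snd
    (fun A : ι ↦ sliceDensity P A) (fun A ↦ measurable_sliceDensity P A) hM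
    (fun s ↦ lintegral_iSup_sliceDensity_le P (fun k ↦ (s k).2.1) fun k ↦ (s k).2.2)
  have hfin : IsFiniteMeasure (P.snd.withDensity G) :=
    isFiniteMeasure_withDensity (hGM.trans_lt hM.lt_top).ne
  refine ⟨P.snd.withDensity G, by simpa using hGM, hfin,
    le_of_forall_prod_le fun A B hA hB ↦ ?_⟩
  rw [Measure.prod_prod]
  -- Null events are outside the index family, but rectangles over them have no mass under `P`.
  by_cases hA0 : P.fst A = 0
  · refine le_trans (measure_mono ?_) ((Measure.fst_apply hA).symm.trans hA0).le |>.trans zero_le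
    exact fun p hp ↦ hp.1
  · rw [withDensity_apply _ hB, ← ENNReal.div_le_iff' hA0 (measure_ne_top _ _),
      ← setLIntegral_sliceDensity P hB]
    exact lintegral_mono_ae (ae_restrict_of_ae (hGle ⟨A, hA, hA0⟩))

end Leakage

end BayesBound

/-! ### The two Bayes risk bounds. -/

theorem mainTheorem1 {𝓦 𝓧 𝓥 : Type*} [MeasurableSpace 𝓦] [MeasurableSpace 𝓧] [MeasurableSpace 𝓥]
    (π : Measure 𝓦) [IsProbabilityMeasure π] (κ : Kernel 𝓦 𝓧) [IsMarkovKernel κ]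
    (ℓ : 𝓦 → 𝓥 → ℝ≥0) (hℓ : Measurable (Function.uncurry ℓ)) :
    (∀ α : ℝ, 1 < α → ∀ ρ : ℝ, 0 < ρ →
      (ρ : EReal) * (1 - (EReal.exp ((((α - 1) / α : ℝ) : EReal) *
          BayesBound.upperAdd (BayesBound.sibsonMI α (π ⊗ₘ κ))
            (ENNReal.log (BayesBound.smallBall ℓ π ρ))) : EReal))
        ≤ (BayesBound.bayesianRisk ℓ (π ⊗ₘ κ) : EReal)) ∧
    (⨆ (ρ : ℝ) (_ : 0 < ρ),
      (ρ : EReal) * (1 - (EReal.exp (BayesBound.upperAdd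
          (BayesBound.maximalLeakage (π ⊗ₘ κ))
            (ENNReal.log (BayesBound.smallBall ℓ π ρ))) : EReal)))
        ≤ (BayesBound.bayesianRisk ℓ (π ⊗ₘ κ) : EReal) := by
  have hfst : (π ⊗ₘ κ).fst = π := Measure.fst_compProd _ _
  refine ⟨fun α hα ρ hρ ↦ BayesBound.le_bayesianRisk hℓ _ hρ fun φ hφ ↦ ?_,
    iSup₂_le fun ρ hρ ↦ BayesBound.le_bayesianRisk hℓ _ hρ fun φ hφ ↦ ?_⟩
  · have hc : 0 < (α - 1) / α := div_pos (by linarith) (by linarith)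
    -- The factor `(α - 1) / α` moves to the left so that the infimum over `Q` stands directly
    -- inside `upperAdd`.
    rw [← ENNReal.exp_log ((π ⊗ₘ κ) _), EReal.exp_le_exp_iff, BayesBound.le_coe_mul_iff hc]
    refine BayesBound.le_upperAdd_iInf fun Q ↦ ?_
    rw [hfst, ← BayesBound.le_coe_mul_iff hc]
    refine BayesBound.log_measure_le_renyiDiv hα _ _
      (BayesBound.measurableSet_successSet hℓ hφ ρ) ?_
    simpa using BayesBound.prod_successSet_le hℓ hφ ρ π (Q : Measure 𝓧)
  · by_cases hL : BayesBound.maximalLeakage (π ⊗ₘ κ) = ⊤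
    · simp [hL, BayesBound.top_upperAdd]
    · obtain ⟨ν, hν, _, hle⟩ := BayesBound.exists_le_prod_of_maximalLeakage_ne_top _ hL
      rw [hfst] at hle
      refine le_trans ?_ (EReal.exp_monotone (BayesBound.add_le_upperAdd _ _))
      rw [EReal.exp_add, ENNReal.exp_log, mul_comm]
      exact (hle _).trans ((BayesBound.prod_successSet_le hℓ hφ ρ π ν).trans
        (mul_le_mul_right hν _))
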